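/- Let $R$ be an associative ring with identity; modules are unital left $R$-modules. Let $\mathfrak X$ be any class of $R$-modules containing all projective $R$-modules. An $R$-module $G$ is called $\mathfrak X$-Gorenstein projective if there is an exact sequence of projective $R$-modules $\cdots\to P_1\to P_0\to P^0\to P^1\to\cdots$ that remains exact after applying $\operatorname{Hom}_R(-,X)$ for every $X\in\mathfrak X$, and such that $G\cong\operatorname{Ker}(P_0\to P^0)$; when $\mathfrak X$ is the class of projective modules, $G$ is called Gorenstein projective. For an $R$-module $M$ let $\mathfrak X\text{-}\mathrm{Gpd}(M)$ (respectively $\mathrm{Gpd}(M)$) be the least $n\ge 0$ for which there is an exact sequence $0\to G_n\to\cdots\to G_0\to M\to 0$ with all $G_i$ $\mathfrak X$-Gorenstein projective (respectively Gorenstein projective), and $\infty$ if there is no such $n$; let $\mathrm{pd}(M)$ be the projective dimension of $M$. Put $$l.\mathrm{FGPD}(R)=\sup\{\mathrm{Gpd}(M)\mid \mathrm{Gpd}(M)<\infty\},$$ $$l.\mathfrak X\text{-}\mathrm{FGPD}(R)=\sup\{\mathfrak X\text{-}\mathrm{Gpd}(M)\mid \mathfrak X\text{-}\mathrm{Gpd}(M)<\infty\},$$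 $$l.\mathrm{FPD}(R)=\sup\{\mathrm{pd}(M)\mid \mathrm{pd}(M)<\infty\},$$ the suprema being taken over all $R$-modules $M$, with values in $\{0,1,2,\dots\}\cup\{\infty\}$. Then $$l.\mathrm{FGPD}(R)=l.\mathfrak X\text{-}\mathrm{FGPD}(R)=l.\mathrm{FPD}(R).$$ -/

import Mathlib

open CategoryTheory

universe u

namespace XGorenstein

variable {R : Type u} [Ring R]

/-- An `𝔛`-complete projective resolution of the left `R`-module `G`: an exact sequence
`⋯ → P (-1) → P 0 → P 1 → P 2 → ⋯` of projective modules that stays exact after applying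
`Hom_R(-, X)` for every `X` in `𝔛`, together with an identification of `G` with
`Ker (P 0 → P 1)`. -/
structure CompleteProjectiveResolution (𝔛 : ObjectProperty (ModuleCat.{u} R))
    (G : ModuleCat.{u} R) where
  P : ℤ → ModuleCat.{u} R
  d : ∀ i : ℤ, P i →ₗ[R] P (i + 1)
  projective : ∀ i : ℤ, Module.Projective R (P i)
  exact : ∀ i : ℤ, Function.Exact (d i) (d (i + 1))
  hom_exact : ∀ X : ModuleCat.{u} R, 𝔛 X → ∀ i : ℤ,
    Function.Exact (fun g : P (i + 1 + 1) →ₗ[R] X => g ∘ₗ d (i + 1))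
      (fun f : P (i + 1) →ₗ[R] X => f ∘ₗ d i)
  kerEquiv : G ≃ₗ[R] LinearMap.ker (d 0)

/-- The class of `𝔛`-Gorenstein projective left `R`-modules. -/
def IsXGorensteinProjective (𝔛 : ObjectProperty (ModuleCat.{u} R)) :
    ObjectProperty (ModuleCat.{u} R) :=
  fun G => Nonempty (CompleteProjectiveResolution 𝔛 G)

/-- The class of projective left `R`-modules. -/
def projectives (R : Type u) [Ring R] : ObjectProperty (ModuleCat.{u} R) :=
  fun M => Module.Projective R M

/-- The class of Gorenstein projective left `R`-modules: the complete projective resolution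
has to stay exact under `Hom_R(-, Q)` for every projective `Q`. -/
def IsGorensteinProjective (R : Type u) [Ring R] : ObjectProperty (ModuleCat.{u} R) :=
  IsXGorensteinProjective (projectives R)

/-- An exact sequence `0 → G n → ⋯ → G 1 → G 0 → M → 0` with all `G i` in the class `𝒞`.
The sequence is continued by zero modules beyond degree `n`. -/
structure FiniteResolution (𝒞 : ObjectProperty (ModuleCat.{u} R)) (M : ModuleCat.{u} R)
    (n : ℕ) where
  G : ℕ → ModuleCat.{u} R
  d : ∀ i : ℕ, G (i + 1) →ₗ[R] G i
  ε : G 0 →ₗ[R] M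
  mem : ∀ i ≤ n, 𝒞 (G i)
  eq_zero : ∀ i > n, Subsingleton (G i)
  exact : ∀ i : ℕ, Function.Exact (d (i + 1)) (d i)
  exact_zero : Function.Exact (d 0) ε
  surjective : Function.Surjective ε

/-- The least length of a finite resolution of `M` by modules of the class `𝒞`, and `⊤` if
there is none. -/
noncomputable def resolutionDim (𝒞 : ObjectProperty (ModuleCat.{u} R))
    (M : ModuleCat.{u} R) : ℕ∞ :=
  sInf {d : ℕ∞ | ∃ n : ℕ, d = n ∧ Nonempty (FiniteResolution 𝒞 M n)}

/-- The `𝔛`-Gorenstein projective dimension `𝔛-Gpd(M)`. -/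
noncomputable def xGpd (𝔛 : ObjectProperty (ModuleCat.{u} R)) (M : ModuleCat.{u} R) : ℕ∞ :=
  resolutionDim (IsXGorensteinProjective 𝔛) M

/-- The Gorenstein projective dimension `Gpd(M)`. -/
noncomputable def gpd (M : ModuleCat.{u} R) : ℕ∞ :=
  resolutionDim (IsGorensteinProjective R) M

/-- The left finitistic `𝔛`-Gorenstein projective dimension of `R`. -/
noncomputable def leftXFGPD (𝔛 : ObjectProperty (ModuleCat.{u} R)) : ℕ∞ :=
  sSup {d : ℕ∞ | ∃ M : ModuleCat.{u} R, xGpd 𝔛 M = d ∧ d < ⊤}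

/-- The left finitistic Gorenstein projective dimension of `R`. -/
noncomputable def leftFGPD (R : Type u) [Ring R] : ℕ∞ :=
  sSup {d : ℕ∞ | ∃ M : ModuleCat.{u} R, gpd M = d ∧ d < ⊤}

/-- The left finitistic projective dimension of `R`. Mathlib's `projectiveDimension` takes
values in `WithBot ℕ∞` and is `⊥` exactly on zero modules; those contribute nothing to the
supremum, as they would with the convention `pd 0 = 0`. -/
noncomputable def leftFPD (R : Type u) [Ring R] : ℕ∞ :=
  sSup {d : ℕ∞ | ∃ M : ModuleCat.{u} R, projectiveDimension M = (d : WithBot ℕ∞) ∧ d < ⊤}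

end XGorenstein

namespace XGorenstein

open Abelian

variable {R : Type u} [Ring R]

/-! Gorenstein projectives are the case where `𝔛` is the class of projectives, so it suffices to
prove `𝔛-FGPD = FPD` for every `𝔛` containing them.

The key is that `𝔛-Gpd(M) ≤ n` exactly when `M` embeds into some `L` with `pd L ≤ n` and
`𝔛`-Gorenstein projective cokernel (`exists_embedding_of_finiteResolution`,
`nonempty_finiteResolution_of_embedding`). If `𝔛-Gpd(M) = n > 0`, then `pd L = n`, since a smaller
`pd L` would shorten the resolution of `M`; so `𝔛-FGPD ≤ FPD`. Conversely, if `pd M` is finite, the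
cokernel `G` has finite projective dimension and no higher `Ext` into projectives, hence is
projective. Thus `pd M = 𝔛-Gpd(M)`, and `FPD ≤ 𝔛-FGPD`.

Complete resolutions are traded for membership in the largest `𝔛`-coresolving class
(`isXGorensteinProjective_iff`): closure properties then need only a suitable coresolving class. -/

/-- The sequence `0 → A → B → C → 0` of modules is exact. -/
structure IsShortExact {A B C : ModuleCat.{u} R} (f : A →ₗ[R] B) (g : B →ₗ[R] C) : Prop where
  injective : Function.Injective f
  exact : Function.Exact f g
  surjective : Function.Surjective g

/-! ### Diagram constructions with short exact sequences -/

namespace IsShortExact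

variable {A B C : ModuleCat.{u} R} {f : A →ₗ[R] B} {g : B →ₗ[R] C}

lemma apply_apply (h : IsShortExact f g) (x : A) : g (f x) = 0 :=
  (h.exact (f x)).2 ⟨x, rfl⟩

lemma shortExact (h : IsShortExact f g) :
    (ShortComplex.mk (ModuleCat.ofHom f) (ModuleCat.ofHom g)
      (by ext x; exact h.apply_apply x)).ShortExact :=
  ModuleCat.shortComplex_shortExact _ h.exact h.injective h.surjective

/-- A map that vanishes on the submodule factors through the quotient. -/
lemma exists_factor (h : IsShortExact f g) {N : Type*} [AddCommGroup N] [Module R N]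
    (k : B →ₗ[R] N) (hk : ∀ x, k (f x) = 0) : ∃ l : C →ₗ[R] N, ∀ x, l (g x) = k x := by
  have hker : LinearMap.ker g ≤ LinearMap.ker k := by
    intro x hx
    obtain ⟨y, rfl⟩ := (h.exact x).1 hx
    exact hk y
  refine ⟨(LinearMap.ker g).liftQ k hker ∘ₗ
    (g.quotKerEquivOfSurjective h.surjective).symm.toLinearMap, fun x => ?_⟩
  have : (g.quotKerEquivOfSurjective h.surjective).symm (g x) = Submodule.Quotient.mk x := by
    rw [LinearEquiv.symm_apply_eq]
    rfl
  simp [this]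

/-- The cokernel sequence of an injective map. -/
lemma of_injective {A B : ModuleCat.{u} R} (f : A →ₗ[R] B) (hf : Function.Injective f) :
    IsShortExact (C := ModuleCat.of R (B ⧸ LinearMap.range f)) f (LinearMap.range f).mkQ where
  injective := hf
  exact := LinearMap.exact_map_mkQ_range f
  surjective := Submodule.mkQ_surjective _

/-- The kernel sequence of a surjective map. -/
lemma of_surjective {B C : ModuleCat.{u} R} (g : B →ₗ[R] C) (hg : Function.Surjective g) :
    IsShortExact (A := ModuleCat.of R (LinearMap.ker g)) (LinearMap.ker g).subtype g where
  injective := Submodule.subtype_injective _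
  exact := LinearMap.exact_subtype_ker_map g
  surjective := hg

/-- For submodules `A ⊆ B ⊆ D` there is an exact sequence `0 → B / A → D / A → D / B → 0`. -/
lemma exists_quotient (h : IsShortExact f g) {D E : ModuleCat.{u} R} {i : B →ₗ[R] D}
    {p : D →ₗ[R] E} (h' : IsShortExact i p) :
    ∃ (L : ModuleCat.{u} R) (q : D →ₗ[R] L) (c : C →ₗ[R] L) (e : L →ₗ[R] E),
      IsShortExact (i ∘ₗ f) q ∧ IsShortExact c e := by
  have hs := of_injective (i ∘ₗ f) (h'.injective.comp h.injective)
  set q := (LinearMap.range (i ∘ₗ f)).mkQ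
  obtain ⟨c, hc⟩ := h.exists_factor (q ∘ₗ i) (fun x => hs.apply_apply x)
  obtain ⟨e, he⟩ := hs.exists_factor p (fun x => h'.apply_apply (f x))
  refine ⟨_, q, c, e, hs, ?_, ?_, ?_⟩
  · rw [injective_iff_map_eq_zero]
    intro z hz
    obtain ⟨x, rfl⟩ := h.surjective z
    rw [hc] at hz
    obtain ⟨y, hy⟩ := (hs.exact _).1 hz
    rw [← h'.injective hy]
    exact h.apply_apply y
  · intro z
    obtain ⟨x, rfl⟩ := hs.surjective z
    constructor
    · intro hz
      rw [he] at hz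
      obtain ⟨y, rfl⟩ := (h'.exact x).1 hz
      exact ⟨g y, hc y⟩
    · rintro ⟨z, hz⟩
      obtain ⟨y, rfl⟩ := h.surjective z
      rw [← hz, hc]
      exact (he (i y)).trans (h'.apply_apply y)
  · intro z
    obtain ⟨x, rfl⟩ := h'.surjective z
    exact ⟨q x, he x⟩

/-- The pullback of a surjection `Q → B` with kernel `D` along an inclusion `A → B`. -/
lemma exists_preimage (h : IsShortExact f g) {D Q : ModuleCat.{u} R} {i : D →ₗ[R] Q}
    {p : Q →ₗ[R] B} (h' : IsShortExact i p) :
    ∃ (H : ModuleCat.{u} R) (j : H →ₗ[R] Q) (k : D →ₗ[R] H) (r : H →ₗ[R] A),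
      IsShortExact j (g ∘ₗ p) ∧ IsShortExact k r := by
  have hs := of_surjective (g ∘ₗ p) (h.surjective.comp h'.surjective)
  have hr : ∀ x : LinearMap.ker (g ∘ₗ p), p x ∈ LinearMap.range f :=
    fun x => (h.exact _).1 x.2
  let e := LinearEquiv.ofInjective f h.injective
  let r : LinearMap.ker (g ∘ₗ p) →ₗ[R] A :=
    e.symm.toLinearMap ∘ₗ
      LinearMap.codRestrict (LinearMap.range f) (p ∘ₗ (LinearMap.ker (g ∘ₗ p)).subtype) hr
  have hfr : ∀ x, f (r x) = p x := fun x =>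
    congrArg Subtype.val (e.apply_symm_apply ⟨p x, hr x⟩)
  let k : D →ₗ[R] LinearMap.ker (g ∘ₗ p) :=
    LinearMap.codRestrict _ i (fun x => by simp [h'.apply_apply])
  refine ⟨_, _, k, r, hs, ?_, ?_, ?_⟩
  · intro x y hxy
    exact h'.injective (congrArg Subtype.val hxy)
  · intro x
    have : r x = 0 ↔ p x = 0 := by
      rw [← hfr, map_eq_zero_iff f h.injective]
    rw [this, h'.exact]
    constructor
    · rintro ⟨y, hy⟩
      exact ⟨y, Subtype.ext hy⟩
    · rintro ⟨y, hy⟩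
      exact ⟨y, congrArg Subtype.val hy⟩
  · intro a
    obtain ⟨x, hx⟩ := h'.surjective (f a)
    refine ⟨⟨x, by simp [hx, h.apply_apply]⟩, h.injective ((hfr _).trans hx)⟩

/-- The pushout of two injections with common source. -/
lemma exists_pushout (h : IsShortExact f g) {D E : ModuleCat.{u} R} {i : A →ₗ[R] D}
    {p : D →ₗ[R] E} (h' : IsShortExact i p) :
    ∃ (T : ModuleCat.{u} R) (b : B →ₗ[R] T) (d : D →ₗ[R] T) (c : T →ₗ[R] C) (e : T →ₗ[R] E),
      IsShortExact b e ∧ IsShortExact d c := by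
  -- The sign makes the two maps from `A` into the quotient of `B × D` agree.
  have hs := of_injective (A := A) (B := ModuleCat.of R (B × D)) (f.prod (-i))
    (fun x y hxy => h.injective (congrArg Prod.fst hxy))
  set q := (LinearMap.range (f.prod (-i))).mkQ
  obtain ⟨c, hc⟩ := hs.exists_factor (g ∘ₗ LinearMap.fst R B D) (fun x => h.apply_apply x)
  obtain ⟨e, he⟩ := hs.exists_factor (p ∘ₗ LinearMap.snd R B D)
    (fun x => by simp [h'.apply_apply])
  refine ⟨_, q ∘ₗ LinearMap.inl R B D, q ∘ₗ LinearMap.inr R B D, c, e, ⟨?_, ?_, ?_⟩,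
    ⟨?_, ?_, ?_⟩⟩
  · rw [injective_iff_map_eq_zero]
    intro x hx
    obtain ⟨y, hy⟩ := (hs.exact (x, 0)).1 hx
    have h1 : f y = x := congrArg Prod.fst hy
    have h2 : -i y = 0 := congrArg Prod.snd hy
    rw [neg_eq_zero, map_eq_zero_iff i h'.injective] at h2
    rw [← h1, h2, map_zero]
  · intro z
    obtain ⟨⟨x, y⟩, rfl⟩ := hs.surjective z
    constructor
    · intro hz
      obtain ⟨w, rfl⟩ := (h'.exact y).1 ((he (x, y)).symm.trans hz)
      refine ⟨x + f w, ?_⟩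
      rw [← sub_eq_zero]
      refine (map_sub q (x + f w, 0) (x, i w)).symm.trans ((hs.exact _).2 ⟨w, ?_⟩)
      simp
    · rintro ⟨w, hw⟩
      rw [← hw]
      exact (he (w, 0)).trans (map_zero p)
  · intro z
    obtain ⟨y, rfl⟩ := h'.surjective z
    exact ⟨q (0, y), he (0, y)⟩
  · rw [injective_iff_map_eq_zero]
    intro x hx
    obtain ⟨y, hy⟩ := (hs.exact (0, x)).1 hx
    have h1 : f y = 0 := congrArg Prod.fst hy
    have h2 : -i y = x := congrArg Prod.snd hy
    rw [map_eq_zero_iff f h.injective] at h1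
    rw [← h2, h1, map_zero, neg_zero]
  · intro z
    obtain ⟨⟨x, y⟩, rfl⟩ := hs.surjective z
    constructor
    · intro hz
      obtain ⟨w, rfl⟩ := (h.exact x).1 ((hc (x, y)).symm.trans hz)
      refine ⟨y + i w, ?_⟩
      rw [← sub_eq_zero]
      refine (map_sub q (0, y + i w) (f w, y)).symm.trans ((hs.exact _).2 ⟨-w, ?_⟩)
      simp
    · rintro ⟨w, hw⟩
      rw [← hw]
      exact (hc (0, w)).trans (map_zero g)
  · intro z
    obtain ⟨x, rfl⟩ := h.surjective z
    exact ⟨q (x, 0), hc (x, 0)⟩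

/-- Embeddings of the outer terms of a short exact sequence `0 → A → B → C → 0`, the first of
which extends to `B`, combine to an embedding of `B`, and the cokernels form a short exact
sequence. -/
lemma exists_horseshoe (h : IsShortExact f g) {P A' Q C' : ModuleCat.{u} R}
    {i : A →ₗ[R] P} {p : P →ₗ[R] A'} (hA : IsShortExact i p)
    {j : C →ₗ[R] Q} {q : Q →ₗ[R] C'} (hC : IsShortExact j q)
    (φ : B →ₗ[R] P) (hφ : ∀ x, φ (f x) = i x) :
    ∃ (B' : ModuleCat.{u} R) (s : B →ₗ[R] ModuleCat.of R (P × Q))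
      (t : ModuleCat.of R (P × Q) →ₗ[R] B') (f' : A' →ₗ[R] B') (g' : B' →ₗ[R] C'),
      IsShortExact s t ∧ IsShortExact f' g' := by
  have hs := of_injective (A := B) (B := ModuleCat.of R (P × Q)) (φ.prod (j ∘ₗ g)) (by
    rw [injective_iff_map_eq_zero]
    intro x hx
    have h1 : φ x = 0 := congrArg Prod.fst hx
    have h2 : j (g x) = 0 := congrArg Prod.snd hx
    rw [map_eq_zero_iff j hC.injective] at h2
    obtain ⟨y, rfl⟩ := (h.exact x).1 h2
    rw [hφ, map_eq_zero_iff i hA.injective] at h1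
    rw [h1, map_zero])
  set t := (LinearMap.range (φ.prod (j ∘ₗ g))).mkQ
  obtain ⟨f', hf'⟩ := hA.exists_factor (t ∘ₗ LinearMap.inl R P Q) (fun x => by
    refine (hs.exact _).2 ⟨f x, ?_⟩
    simp [hφ, h.apply_apply])
  obtain ⟨g', hg'⟩ := hs.exists_factor (q ∘ₗ LinearMap.snd R P Q)
    (fun x => hC.apply_apply (g x))
  refine ⟨_, _, t, f', g', hs, ?_, ?_, ?_⟩
  · rw [injective_iff_map_eq_zero]
    intro z hz
    obtain ⟨x, rfl⟩ := hA.surjective z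
    rw [hf'] at hz
    obtain ⟨y, hy⟩ := (hs.exact (x, 0)).1 hz
    have h1 : φ y = x := congrArg Prod.fst hy
    have h2 : j (g y) = 0 := congrArg Prod.snd hy
    rw [map_eq_zero_iff j hC.injective] at h2
    obtain ⟨w, rfl⟩ := (h.exact y).1 h2
    rw [← h1, hφ, hA.apply_apply]
  · intro z
    obtain ⟨⟨x, y⟩, rfl⟩ := hs.surjective z
    constructor
    · intro hz
      obtain ⟨c, rfl⟩ := (hC.exact y).1 ((hg' (x, y)).symm.trans hz)
      obtain ⟨b, rfl⟩ := h.surjective c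
      refine ⟨p (x - φ b), ?_⟩
      rw [hf', ← sub_eq_zero]
      refine (map_sub t (x - φ b, 0) (x, j (g b))).symm.trans ((hs.exact _).2 ⟨-b, ?_⟩)
      simp
    · rintro ⟨w, hw⟩
      obtain ⟨x', rfl⟩ := hA.surjective w
      rw [← hw, hf']
      exact (hg' (x', 0)).trans (map_zero q)
  · intro z
    obtain ⟨y, rfl⟩ := hC.surjective z
    exact ⟨t (0, y), hg' (0, y)⟩

end IsShortExact

/-! ### Projective covers, `Ext` and dimension shifting -/

/-- Every module is a quotient of a projective module. -/
lemma exists_projective_cover (M : ModuleCat.{u} R) :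
    ∃ (K P : ModuleCat.{u} R) (f : K →ₗ[R] P) (g : P →ₗ[R] M),
      Module.Projective R P ∧ IsShortExact f g :=
  ⟨_, ModuleCat.of R (M →₀ R), _, Finsupp.linearCombination R (id : M → M),
    inferInstanceAs (Module.Projective R (M →₀ R)),
    IsShortExact.of_surjective _ (Finsupp.linearCombination_id_surjective R M)⟩

namespace IsShortExact

variable {A B C : ModuleCat.{u} R} {f : A →ₗ[R] B} {g : B →ₗ[R] C}

/-- If `Ext¹(C, X) = 0`, then maps `A → X` extend to `B`. -/
lemma exists_extension (h : IsShortExact f g) {X : ModuleCat.{u} R}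
    (hX : ∀ e : Ext C X 1, e = 0) (φ : A →ₗ[R] X) : ∃ ψ : B →ₗ[R] X, ∀ x, ψ (f x) = φ x := by
  obtain ⟨y, hy⟩ := Ext.contravariant_sequence_exact₁ h.shortExact X
    (Ext.mk₀ (ModuleCat.ofHom φ)) (add_zero 1) (hX _)
  obtain ⟨ψ, rfl⟩ := (Ext.mk₀_bijective _ _).2 y
  rw [Ext.mk₀_comp_mk₀] at hy
  have := (Ext.mk₀_bijective _ _).1 hy
  exact ⟨ψ.hom, fun x => ConcreteCategory.congr_hom this x⟩

/-- As `Ext¹(B, X) = 0`, every class comes from a map `A → X` by the connecting map, which kills the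
maps that extend to `B`. -/
lemma ext_one_eq_zero (h : IsShortExact f g) [hB : Module.Projective R B] {X : ModuleCat.{u} R}
    (hX : ∀ φ : A →ₗ[R] X, ∃ ψ : B →ₗ[R] X, ∀ x, ψ (f x) = φ x) (e : Ext C X 1) : e = 0 := by
  have : Projective B := (IsProjective.iff_projective B).1 hB
  obtain ⟨y, rfl⟩ := Ext.contravariant_sequence_exact₃ h.shortExact X e
    (Ext.eq_zero_of_projective _) (add_zero 1)
  obtain ⟨φ, rfl⟩ := (Ext.mk₀_bijective _ _).2 y
  obtain ⟨ψ, hψ⟩ := hX φ.hom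
  have hφ : φ = ModuleCat.ofHom f ≫ ModuleCat.ofHom ψ := by
    ext x
    exact (hψ x).symm
  rw [hφ, ← Ext.mk₀_comp_mk₀]
  exact h.shortExact.extClass_comp_assoc _

lemma ext_succ_eq_zero (h : IsShortExact f g) [hB : Module.Projective R B] {X : ModuleCat.{u} R}
    {n : ℕ} (hX : ∀ e : Ext A X (n + 1), e = 0) (e : Ext C X (n + 1 + 1)) : e = 0 := by
  have : Projective B := (IsProjective.iff_projective B).1 hB
  obtain ⟨y, rfl⟩ := Ext.contravariant_sequence_exact₃ h.shortExact X e
    (Ext.eq_zero_of_projective _) (add_comm 1 (n + 1))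
  rw [hX y, Ext.comp_zero]

lemma ext_kernel_eq_zero (h : IsShortExact f g) [hB : Module.Projective R B]
    {X : ModuleCat.{u} R} {n : ℕ} (hX : ∀ e : Ext C X (n + 1 + 1), e = 0)
    (e : Ext A X (n + 1)) : e = 0 := by
  have : Projective B := (IsProjective.iff_projective B).1 hB
  obtain ⟨y, rfl⟩ := Ext.contravariant_sequence_exact₁ h.shortExact X e
    (add_comm 1 (n + 1)) (hX _)
  rw [Ext.eq_zero_of_projective y, Ext.comp_zero]

lemma ext_middle_eq_zero (h : IsShortExact f g) {X : ModuleCat.{u} R} {n : ℕ}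
    (hA : ∀ e : Ext A X n, e = 0) (hC : ∀ e : Ext C X n, e = 0) (e : Ext B X n) : e = 0 := by
  obtain ⟨y, rfl⟩ := Ext.contravariant_sequence_exact₂ h.shortExact X e (hA _)
  rw [hC y, Ext.comp_zero]

end IsShortExact

/-- A module of finite projective dimension with vanishing higher `Ext` into projective modules
is projective. -/
lemma hasProjectiveDimensionLT_one_of_ext_eq_zero {G : ModuleCat.{u} R}
    (hG : ∀ Q : ModuleCat.{u} R, Module.Projective R Q → ∀ (n : ℕ) (e : Ext G Q (n + 1)), e = 0)
    (k : ℕ) (hk : HasProjectiveDimensionLT G (k + 1)) : HasProjectiveDimensionLT G 1 := by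
  induction k with
  | zero => exact hk
  | succ k ih =>
    refine ih (HasProjectiveDimensionLT.mk fun i hi Y e => ?_)
    obtain hi | rfl := lt_or_eq_of_le hi
    · exact e.eq_zero_of_hasProjectiveDimensionLT (k + 1 + 1) hi
    -- In the one new degree `k + 1`, the obstruction to lifting `e` to `Ext(G, Q)` lies in
    -- `Ext^(k+2)(G, K) = 0`, and `Ext^(k+1)(G, Q) = 0` by `hG`.
    · obtain ⟨K, Q, f, g, hQ, h⟩ := exists_projective_cover Y
      obtain ⟨y, rfl⟩ := Ext.covariant_sequence_exact₃ G h.shortExact e rfl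
        (Ext.eq_zero_of_hasProjectiveDimensionLT _ (k + 1 + 1) le_rfl)
      rw [hG Q hQ k y, Ext.zero_comp]

/-! ### Coresolving classes and Gorenstein projectives -/

/-- A class of modules is `𝔛`-coresolving if its members have vanishing higher `Ext` into `𝔛`
and embed into projective modules with cokernels in the class. -/
def IsCoresolving (𝔛 𝒢 : ObjectProperty (ModuleCat.{u} R)) : Prop :=
  ∀ H, 𝒢 H →
    (∀ X, 𝔛 X → ∀ (n : ℕ) (e : Ext H X (n + 1)), e = 0) ∧
      ∃ (P H' : ModuleCat.{u} R) (f : H →ₗ[R] P) (g : P →ₗ[R] H'),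
        Module.Projective R P ∧ 𝒢 H' ∧ IsShortExact f g

/-- The largest `𝔛`-coresolving class. -/
def maxCoresolving (𝔛 : ObjectProperty (ModuleCat.{u} R)) : ObjectProperty (ModuleCat.{u} R) :=
  fun G => ∃ 𝒢, IsCoresolving 𝔛 𝒢 ∧ 𝒢 G

variable {𝔛 : ObjectProperty (ModuleCat.{u} R)}

lemma isCoresolving_maxCoresolving : IsCoresolving 𝔛 (maxCoresolving 𝔛) := by
  rintro H ⟨𝒢, h𝒢, hH⟩
  obtain ⟨h, P, H', f, g, hP, hH', hs⟩ := h𝒢 H hH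
  exact ⟨h, P, H', f, g, hP, ⟨𝒢, h𝒢, hH'⟩, hs⟩

/-- Kernels of surjections from projective modules onto members of the class are members. -/
lemma maxCoresolving_kernel {K P H : ModuleCat.{u} R} {f : K →ₗ[R] P} {g : P →ₗ[R] H}
    (hs : IsShortExact f g) (hP : Module.Projective R P) (hH : maxCoresolving 𝔛 H) :
    maxCoresolving 𝔛 K := by
  refine ⟨fun N => maxCoresolving 𝔛 N ∨ N = K, ?_, Or.inr rfl⟩
  rintro N (hN | rfl)
  · obtain ⟨h, P, H', f, g, hP, hH', hs⟩ := isCoresolving_maxCoresolving N hN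
    exact ⟨h, P, H', f, g, hP, Or.inl hH', hs⟩
  · exact ⟨fun X hX n => hs.ext_kernel_eq_zero ((isCoresolving_maxCoresolving H hH).1 X hX (n + 1)),
      P, H, f, g, hP, Or.inl hH, hs⟩

/-- The largest coresolving class is closed under extensions. -/
lemma maxCoresolving_extension (h𝔛 : ∀ P : ModuleCat.{u} R, Module.Projective R P → 𝔛 P)
    {A B C : ModuleCat.{u} R} {f : A →ₗ[R] B} {g : B →ₗ[R] C}
    (hs : IsShortExact f g) (hA : maxCoresolving 𝔛 A) (hC : maxCoresolving 𝔛 C) :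
    maxCoresolving 𝔛 B := by
  refine ⟨fun N => ∃ (A C : ModuleCat.{u} R) (f : A →ₗ[R] N) (g : N →ₗ[R] C),
    IsShortExact f g ∧ maxCoresolving 𝔛 A ∧ maxCoresolving 𝔛 C, ?_, A, C, f, g, hs, hA, hC⟩
  clear hs hA hC f g
  rintro N ⟨A, C, f, g, hs, hA, hC⟩
  obtain ⟨eA, P, A', i, p, hP, hA', hi⟩ := isCoresolving_maxCoresolving A hA
  obtain ⟨eC, Q, C', j, q, hQ, hC', hj⟩ := isCoresolving_maxCoresolving C hC
  refine ⟨fun X hX n => hs.ext_middle_eq_zero (eA X hX n) (eC X hX n), ?_⟩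
  -- Here `𝔛` must contain the projectives: `Ext¹(C, P) = 0` extends `A → P` to `B`.
  obtain ⟨φ, hφ⟩ := hs.exists_extension (eC P (h𝔛 P hP) 0) i
  obtain ⟨B', s, t, f', g', hst, hfg⟩ := hs.exists_horseshoe hi hj φ hφ
  exact ⟨_, B', s, t, inferInstanceAs (Module.Projective R (P × Q)),
    ⟨A', C', f', g', hfg, hA', hC'⟩, hst⟩

/-- All kernels are treated at once, since dimension shifting moves from `ker d (i + 1)` to `ker d
i`. -/
lemma CompleteProjectiveResolution.ext_eq_zero {G : ModuleCat.{u} R}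
    (c : CompleteProjectiveResolution 𝔛 G) {X : ModuleCat.{u} R} (hX : 𝔛 X) (n : ℕ) :
    ∀ (i : ℤ) (H : ModuleCat.{u} R), (H ≃ₗ[R] LinearMap.ker (c.d i)) →
      ∀ e : Ext H X (n + 1), e = 0 := by
  have key : ∀ (i : ℤ) (H : ModuleCat.{u} R), (H ≃ₗ[R] LinearMap.ker (c.d (i + 1))) →
      ∃ g : c.P i →ₗ[R] H, IsShortExact (A := ModuleCat.of R (LinearMap.ker (c.d i)))
        (LinearMap.ker (c.d i)).subtype g := by
    intro i H ι
    let r : c.P i →ₗ[R] LinearMap.ker (c.d (i + 1)) :=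
      LinearMap.codRestrict _ (c.d i) (fun x => (c.exact i _).2 ⟨x, rfl⟩)
    refine ⟨ι.symm.toLinearMap ∘ₗ r, Submodule.subtype_injective _, ?_, ?_⟩
    · have : LinearMap.ker (c.d i) = LinearMap.ker (ι.symm.toLinearMap ∘ₗ r) := by
        ext x
        rw [LinearMap.mem_ker, LinearMap.mem_ker, LinearMap.comp_apply, LinearEquiv.coe_coe,
          LinearEquiv.map_eq_zero_iff, Subtype.ext_iff]
        rfl
      rw [LinearMap.exact_iff, ← this]
      exact (Submodule.range_subtype _).symm
    · refine ι.symm.surjective.comp ?_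
      rintro ⟨x, hx⟩
      obtain ⟨y, rfl⟩ := (c.exact i x).1 hx
      exact ⟨y, rfl⟩
  induction n with
  | zero =>
    intro i H ι e
    -- A map `φ` on `ker d (j + 2)` pulls back to a map on `P (j + 1)` killed by `d j`;
    -- `Hom`-exactness there extends `φ` to `P (j + 2)`.
    obtain ⟨j, rfl⟩ : ∃ j : ℤ, i = j + 1 + 1 + 1 := ⟨i - 3, by ring⟩
    obtain ⟨g, hs⟩ := key _ H ι
    have := c.projective (j + 1 + 1)
    refine hs.ext_one_eq_zero (fun φ => ?_) e
    have hd : ∀ x, c.d (j + 1) x ∈ LinearMap.ker (c.d (j + 1 + 1)) :=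
      fun x => (c.exact (j + 1) _).2 ⟨x, rfl⟩
    obtain ⟨ψ, hψ⟩ := (c.hom_exact X hX j (φ ∘ₗ LinearMap.codRestrict _ (c.d (j + 1)) hd)).1 (by
      ext x
      have h0 : LinearMap.codRestrict _ (c.d (j + 1)) hd (c.d j x) = 0 :=
        Subtype.ext ((c.exact j _).2 ⟨x, rfl⟩)
      change φ (LinearMap.codRestrict _ (c.d (j + 1)) hd (c.d j x)) = 0
      rw [h0, map_zero])
    refine ⟨ψ, ?_⟩
    rintro ⟨x, hx⟩
    obtain ⟨y, rfl⟩ := (c.exact (j + 1) x).1 hx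
    exact LinearMap.congr_fun hψ y
  | succ n ih =>
    intro i H ι
    obtain ⟨j, rfl⟩ : ∃ j : ℤ, i = j + 1 := ⟨i - 1, by ring⟩
    obtain ⟨g, hs⟩ := key _ H ι
    have := c.projective j
    exact hs.ext_succ_eq_zero (ih j _ (LinearEquiv.refl R _))

lemma maxCoresolving_of_completeProjectiveResolution {G : ModuleCat.{u} R}
    (c : CompleteProjectiveResolution 𝔛 G) : maxCoresolving 𝔛 G := by
  refine ⟨fun H => ∃ i, Nonempty (H ≃ₗ[R] LinearMap.ker (c.d i)), ?_, 0, ⟨c.kerEquiv⟩⟩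
  rintro H ⟨i, ⟨ι⟩⟩
  refine ⟨fun X hX n => c.ext_eq_zero hX n i H ι, c.P i,
    ModuleCat.of R (LinearMap.ker (c.d (i + 1))), (LinearMap.ker (c.d i)).subtype ∘ₗ ι.toLinearMap,
    LinearMap.codRestrict _ (c.d i) (fun x => (c.exact i _).2 ⟨x, rfl⟩), c.projective i,
    ⟨i + 1, ⟨LinearEquiv.refl R _⟩⟩, ?_, ?_, ?_⟩
  · exact (Submodule.subtype_injective _).comp ι.injective
  · intro x
    rw [Subtype.ext_iff]
    constructor
    · intro hx
      exact ⟨ι.symm ⟨x, hx⟩, by simp⟩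
    · rintro ⟨y, rfl⟩
      exact (ι y).2
  · rintro ⟨x, hx⟩
    obtain ⟨y, rfl⟩ := (c.exact i x).1 hx
    exact ⟨y, rfl⟩

/-- A relation that is total on both sides admits bi-infinite chains through any point. -/
lemma exists_int_chain {α : Type*} {r : α → α → Prop} (hr : ∀ a, ∃ b, r a b)
    (hl : ∀ b, ∃ a, r a b) (a : α) : ∃ K : ℤ → α, K 0 = a ∧ ∀ i, r (K i) (K (i + 1)) := by
  choose s hs using hr
  choose p hp using hl
  let K : ℤ → α := fun i => Int.rec (fun n => s^[n] a) (fun n => p^[n + 1] a) i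
  have hneg : ∀ n : ℕ, K (-(n : ℤ)) = p^[n] a := by
    rintro (_ | n)
    · rfl
    · rfl
  refine ⟨K, rfl, fun i => ?_⟩
  obtain ⟨n, rfl | rfl⟩ : ∃ n : ℕ, i = n ∨ i = -((n + 1 : ℕ) : ℤ) := by
    rcases le_or_gt 0 i with h | h
    · exact ⟨i.toNat, Or.inl (by omega)⟩
    · exact ⟨(-i - 1).toNat, Or.inr (by omega)⟩
  · change r (s^[n] a) (s^[n + 1] a)
    rw [Function.iterate_succ_apply']
    exact hs _
  · have : -((n + 1 : ℕ) : ℤ) + 1 = -(n : ℤ) := by push_cast; ring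
    rw [this, hneg, hneg, Function.iterate_succ_apply']
    exact hp _

/-- Embeddings continue the sequence to the right and projective covers to the left; splicing gives
the complex. -/
lemma isXGorensteinProjective_of_maxCoresolving {G : ModuleCat.{u} R}
    (hG : maxCoresolving 𝔛 G) : IsXGorensteinProjective 𝔛 G := by
  obtain ⟨K, hK0, hK⟩ := exists_int_chain
    (r := fun A B : {H // maxCoresolving 𝔛 H} => ∃ (P : ModuleCat.{u} R) (f : A.1 →ₗ[R] P)
      (g : P →ₗ[R] B.1), Module.Projective R P ∧ IsShortExact f g)
    (by
      rintro ⟨A, hA⟩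
      obtain ⟨-, P, B, f, g, hP, hB, hs⟩ := isCoresolving_maxCoresolving A hA
      exact ⟨⟨B, hB⟩, P, f, g, hP, hs⟩)
    (by
      rintro ⟨B, hB⟩
      obtain ⟨A, P, f, g, hP, hs⟩ := exists_projective_cover B
      exact ⟨⟨A, maxCoresolving_kernel hs hP hB⟩, P, f, g, hP, hs⟩)
    ⟨G, hG⟩
  suffices IsXGorensteinProjective 𝔛 (K 0).1 by rwa [hK0] at this
  choose P ι π hP hs using hK
  have hker : ∀ i (x : P i), ι (i + 1) (π i x) = 0 ↔ π i x = 0 := fun i x =>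
    map_eq_zero_iff _ (hs (i + 1)).injective
  refine ⟨⟨P, fun i => ι (i + 1) ∘ₗ π i, hP, fun i x => ?_, fun X hX i f => ?_,
    (LinearEquiv.ofInjective (ι 0) (hs 0).injective).trans (LinearEquiv.ofEq _ _ ?_)⟩⟩
  · refine (hker (i + 1) x).trans (((hs (i + 1)).exact x).trans ?_)
    constructor
    · rintro ⟨y, rfl⟩
      obtain ⟨z, rfl⟩ := (hs i).surjective y
      exact ⟨z, rfl⟩
    · rintro ⟨z, rfl⟩
      exact ⟨π i z, rfl⟩
  · constructor
    · intro hf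
      -- A cocycle factors through `K (i + 2)` and extends to `P (i + 2)` because `Ext¹(K (i + 3),
      -- X) = 0`.
      obtain ⟨φ, hφ⟩ := (hs (i + 1)).exists_factor f (fun y => by
        obtain ⟨z, rfl⟩ := (hs i).surjective y
        exact LinearMap.congr_fun hf z)
      obtain ⟨ψ, hψ⟩ := (hs (i + 1 + 1)).exists_extension
        ((isCoresolving_maxCoresolving _ (K (i + 1 + 1 + 1)).2).1 X hX 0) φ
      refine ⟨ψ, LinearMap.ext fun x => ?_⟩
      exact (hψ _).trans (hφ x)
    · rintro ⟨ψ, rfl⟩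
      refine LinearMap.ext fun x => ?_
      simp [(hs (i + 1)).apply_apply]
  · ext x
    rw [LinearMap.mem_ker, LinearMap.comp_apply, hker, (hs 0).exact]
    rfl

lemma isXGorensteinProjective_iff {G : ModuleCat.{u} R} :
    IsXGorensteinProjective 𝔛 G ↔ maxCoresolving 𝔛 G :=
  ⟨fun ⟨c⟩ => maxCoresolving_of_completeProjectiveResolution c,
    isXGorensteinProjective_of_maxCoresolving⟩

lemma IsXGorensteinProjective.of_linearEquiv {G G' : ModuleCat.{u} R}
    (h : IsXGorensteinProjective 𝔛 G) (e : G' ≃ₗ[R] G) : IsXGorensteinProjective 𝔛 G' := by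
  obtain ⟨c⟩ := h
  exact ⟨{ c with kerEquiv := e.trans c.kerEquiv }⟩

lemma maxCoresolving_of_projective {P : ModuleCat.{u} R} (hP : Module.Projective R P) :
    maxCoresolving 𝔛 P := by
  refine ⟨projectives R, fun H hH => ⟨fun X _ n e => ?_, H, ModuleCat.of R PUnit,
    LinearMap.id, 0, hH, inferInstanceAs (Module.Projective R PUnit.{u + 1}), ?_⟩, hP⟩
  · have : Projective H := (IsProjective.iff_projective H).1 hH
    exact e.eq_zero_of_projective
  · exact ⟨Function.injective_id, fun x => by simp, fun x => ⟨0, rfl⟩⟩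

/-! ### Finite resolutions -/

variable {𝒞 : ObjectProperty (ModuleCat.{u} R)}

/-- A module of the class is its own resolution. -/
lemma FiniteResolution.nonempty_zero {M : ModuleCat.{u} R} (hM : 𝒞 M) :
    Nonempty (FiniteResolution 𝒞 M 0) :=
  ⟨{ G := fun i => Nat.casesOn i M (fun _ => ModuleCat.of R PUnit.{u + 1})
     d := fun _ => 0
     ε := LinearMap.id
     mem := fun i hi => by
      obtain rfl : i = 0 := by omega
      exact hM
     eq_zero := fun i hi => by
      obtain ⟨j, rfl⟩ : ∃ j, i = j + 1 := ⟨i - 1, by omega⟩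
      exact inferInstanceAs (Subsingleton PUnit.{u + 1})
     exact := fun i x => ⟨fun _ => ⟨0, Subsingleton.elim (α := PUnit.{u + 1}) _ _⟩,
      fun _ => rfl⟩
     exact_zero := fun x => ⟨fun h => ⟨0, h.symm⟩, fun ⟨_, h⟩ => h.symm⟩
     surjective := Function.surjective_id }⟩

/-- Splicing a short exact sequence with a resolution of its kernel. -/
lemma FiniteResolution.nonempty_cons {K G M : ModuleCat.{u} R} {f : K →ₗ[R] G} {g : G →ₗ[R] M}
    (hs : IsShortExact f g) (hG : 𝒞 G) {n : ℕ} (c : FiniteResolution 𝒞 K n) :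
    Nonempty (FiniteResolution 𝒞 M (n + 1)) :=
  ⟨{ G := fun i => Nat.casesOn i G c.G
     d := fun i => match i with
      | 0 => f ∘ₗ c.ε
      | i + 1 => c.d i
     ε := g
     mem := fun i hi => match i with
      | 0 => hG
      | i + 1 => c.mem i (by omega)
     eq_zero := fun i hi => match i with
      | 0 => by omega
      | i + 1 => c.eq_zero i (by omega)
     exact := fun i => match i with
      | 0 => fun x => (map_eq_zero_iff f hs.injective).trans (c.exact_zero x)
      | i + 1 => c.exact i
     exact_zero := fun x => (hs.exact x).trans
      ⟨fun ⟨y, hy⟩ => (c.surjective y).imp fun z hz => by rw [← hy, ← hz]; rfl,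
        fun ⟨z, hz⟩ => ⟨c.ε z, hz⟩⟩
     surjective := hs.surjective }⟩

/-- The kernel of the augmentation is resolved by the truncated resolution. -/
lemma FiniteResolution.nonempty_tail {M : ModuleCat.{u} R} {n : ℕ}
    (c : FiniteResolution 𝒞 M (n + 1)) :
    Nonempty (FiniteResolution 𝒞 (ModuleCat.of R (LinearMap.ker c.ε)) n) :=
  ⟨{ G := fun i => c.G (i + 1)
     d := fun i => c.d (i + 1)
     ε := LinearMap.codRestrict _ (c.d 0) (fun x => (c.exact_zero _).2 ⟨x, rfl⟩)
     mem := fun i hi => c.mem (i + 1) (by omega)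
     eq_zero := fun i hi => c.eq_zero (i + 1) (by omega)
     exact := fun i => c.exact (i + 1)
     exact_zero := fun x => Subtype.ext_iff.trans (c.exact 0 x)
     surjective := by
      rintro ⟨x, hx⟩
      obtain ⟨y, rfl⟩ := (c.exact_zero x).1 hx
      exact ⟨y, rfl⟩ }⟩

/-- The augmentation of a resolution of length zero is an isomorphism. -/
lemma FiniteResolution.bijective_of_zero {M : ModuleCat.{u} R} (c : FiniteResolution 𝒞 M 0) :
    Function.Bijective c.ε := by
  refine ⟨?_, c.surjective⟩
  rw [injective_iff_map_eq_zero]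
  intro x hx
  obtain ⟨y, rfl⟩ := (c.exact_zero x).1 hx
  have := c.eq_zero 1 one_pos
  rw [Subsingleton.elim y 0, map_zero]

lemma hasProjectiveDimensionLT_one_of_projective {P : ModuleCat.{u} R}
    (hP : Module.Projective R P) : HasProjectiveDimensionLT P 1 :=
  have : Projective P := (IsProjective.iff_projective P).1 hP
  inferInstance

/-- Modules of projective dimension at most `n` have projective resolutions of length `n`. -/
lemma nonempty_finiteResolution_of_hasProjectiveDimensionLT
    (h𝒞 : ∀ P : ModuleCat.{u} R, Module.Projective R P → 𝒞 P) (n : ℕ) :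
    ∀ M : ModuleCat.{u} R, HasProjectiveDimensionLT M (n + 1) →
      Nonempty (FiniteResolution 𝒞 M n) := by
  induction n with
  | zero =>
    intro M hM
    exact FiniteResolution.nonempty_zero (h𝒞 M ((IsProjective.iff_projective M).2
      (projective_iff_hasProjectiveDimensionLT_one.2 hM)))
  | succ n ih =>
    intro M hM
    obtain ⟨K, P, f, g, hP, hs⟩ := exists_projective_cover M
    obtain ⟨c⟩ := ih K ((hs.shortExact.hasProjectiveDimensionLT_X₃_iff n
      ((IsProjective.iff_projective P).1 hP)).1 hM)
    exact FiniteResolution.nonempty_cons hs (h𝒞 P hP) c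

/-! ### Comparison of dimensions -/

/-- A module with an `𝔛`-Gorenstein projective resolution of length `n` embeds into a module of
projective dimension at most `n` with `𝔛`-Gorenstein projective cokernel. -/
lemma exists_embedding_of_finiteResolution
    (h𝔛 : ∀ P : ModuleCat.{u} R, Module.Projective R P → 𝔛 P) (n : ℕ) :
    ∀ M : ModuleCat.{u} R, FiniteResolution (IsXGorensteinProjective 𝔛) M n →
      ∃ (L G : ModuleCat.{u} R) (f : M →ₗ[R] L) (g : L →ₗ[R] G),
        IsShortExact f g ∧ HasProjectiveDimensionLT L (n + 1) ∧ maxCoresolving 𝔛 G := by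
  induction n with
  | zero =>
    intro M c
    have hM := isXGorensteinProjective_iff.1 ((c.mem 0 le_rfl).of_linearEquiv
      (LinearEquiv.ofBijective c.ε c.bijective_of_zero).symm)
    obtain ⟨-, P, G, f, g, hP, hG, hs⟩ := isCoresolving_maxCoresolving M hM
    exact ⟨P, G, f, g, hs, hasProjectiveDimensionLT_one_of_projective hP, hG⟩
  | succ n ih =>
    intro M c
    obtain ⟨c'⟩ := c.nonempty_tail
    obtain ⟨L', G', f', g', hs', hL', hG'⟩ := ih _ c'
    -- `T` is an extension of `G'` by `c.G 0`, hence embeds into a projective `P` with cokernel `G`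
    -- in the class. Then `L = P / L'` contains `M = T / L'` with cokernel `P / T = G`.
    obtain ⟨T, b, d, t, e, hbe, hdt⟩ :=
      (IsShortExact.of_surjective c.ε c.surjective).exists_pushout hs'
    have hT : maxCoresolving 𝔛 T := maxCoresolving_extension h𝔛 hbe
      (isXGorensteinProjective_iff.1 (c.mem 0 (Nat.zero_le _))) hG'
    obtain ⟨-, P, G, i, p, hP, hG, hs⟩ := isCoresolving_maxCoresolving T hT
    obtain ⟨L, q, f, g, hq, hfg⟩ := hdt.exists_quotient hs
    refine ⟨L, G, f, g, hfg, hq.shortExact.hasProjectiveDimensionLT_X₃ (n + 1) hL' ?_, hG⟩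
    have := hasProjectiveDimensionLT_one_of_projective hP
    exact hasProjectiveDimensionLT_of_ge P 1 (n + 1 + 1) (by omega)

/-- A module that embeds into a module of projective dimension at most `n` with
`𝔛`-Gorenstein projective cokernel has an `𝔛`-Gorenstein projective resolution of length `n`. -/
lemma nonempty_finiteResolution_of_embedding {M L G : ModuleCat.{u} R} {f : M →ₗ[R] L}
    {g : L →ₗ[R] G} (hs : IsShortExact f g) (hG : maxCoresolving 𝔛 G) (n : ℕ)
    (hL : HasProjectiveDimensionLT L (n + 1)) :
    Nonempty (FiniteResolution (IsXGorensteinProjective 𝔛) M n) := by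
  obtain _ | n := n
  · exact FiniteResolution.nonempty_zero (isXGorensteinProjective_iff.2 (maxCoresolving_kernel hs
      ((IsProjective.iff_projective L).2 (projective_iff_hasProjectiveDimensionLT_one.2 hL)) hG))
  · obtain ⟨A, Q, i, p, hQ, hA⟩ := exists_projective_cover L
    -- `H`, the preimage of `M` in `Q`, is also the kernel of `Q → G`, so it lies in the class.
    obtain ⟨H, j, k, r, hj, hk⟩ := hs.exists_preimage hA
    obtain ⟨c⟩ := nonempty_finiteResolution_of_hasProjectiveDimensionLT
      (fun P hP => isXGorensteinProjective_iff.2 (maxCoresolving_of_projective hP)) n A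
      ((hA.shortExact.hasProjectiveDimensionLT_X₃_iff n
        ((IsProjective.iff_projective Q).1 hQ)).1 hL)
    exact FiniteResolution.nonempty_cons hk
      (isXGorensteinProjective_iff.2 (maxCoresolving_kernel hj hQ hG)) c

/-- For modules of finite projective dimension, `𝔛`-Gorenstein projective resolutions are not
shorter than projective ones. -/
lemma hasProjectiveDimensionLT_of_finiteResolution
    (h𝔛 : ∀ P : ModuleCat.{u} R, Module.Projective R P → 𝔛 P) {M : ModuleCat.{u} R} {m n : ℕ}
    (hM : HasProjectiveDimensionLT M n) (c : FiniteResolution (IsXGorensteinProjective 𝔛) M m) :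
    HasProjectiveDimensionLT M (m + 1) := by
  obtain ⟨L, G, f, g, hs, hL, hG⟩ := exists_embedding_of_finiteResolution h𝔛 m M c
  -- The bound is crude; only finiteness matters.
  have hG' : HasProjectiveDimensionLT G (n + m + 1) :=
    hs.shortExact.hasProjectiveDimensionLT_X₃ (n + m)
      (hasProjectiveDimensionLT_of_ge M n _ (by omega))
      (hasProjectiveDimensionLT_of_ge L (m + 1) _ (by omega))
  have hG1 := hasProjectiveDimensionLT_one_of_ext_eq_zero
    (fun Q hQ => (isCoresolving_maxCoresolving G hG).1 Q (h𝔛 Q hQ)) _ hG'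
  exact hs.shortExact.hasProjectiveDimensionLT_X₁ (m + 1) hL
    (hasProjectiveDimensionLT_of_ge G 1 _ (by omega))

lemma resolutionDim_eq_coe {M : ModuleCat.{u} R} {n : ℕ} (hn : Nonempty (FiniteResolution 𝒞 M n))
    (hmin : ∀ m, Nonempty (FiniteResolution 𝒞 M m) → n ≤ m) : resolutionDim 𝒞 M = n := by
  refine le_antisymm (sInf_le ⟨n, rfl, hn⟩) (le_sInf ?_)
  rintro _ ⟨m, rfl, hm⟩
  exact_mod_cast hmin m hm

lemma exists_of_resolutionDim_lt_top {M : ModuleCat.{u} R} (h : resolutionDim 𝒞 M < ⊤) :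
    ∃ n : ℕ, resolutionDim 𝒞 M = n ∧ Nonempty (FiniteResolution 𝒞 M n) ∧
      ∀ m, Nonempty (FiniteResolution 𝒞 M m) → n ≤ m := by
  have hne : {d : ℕ∞ | ∃ n : ℕ, d = n ∧ Nonempty (FiniteResolution 𝒞 M n)}.Nonempty := by
    rw [Set.nonempty_iff_ne_empty]
    intro he
    rw [resolutionDim, he, sInf_empty] at h
    exact lt_irrefl _ h
  obtain ⟨n, hn, hc⟩ := csInf_mem hne
  refine ⟨n, hn, hc, fun m hm => ?_⟩
  have : resolutionDim 𝒞 M ≤ m := sInf_le ⟨m, rfl, hm⟩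
  rw [resolutionDim, hn] at this
  exact_mod_cast this

theorem leftXFGPD_eq_leftFPD (h𝔛 : ∀ P : ModuleCat.{u} R, Module.Projective R P → 𝔛 P) :
    leftXFGPD 𝔛 = leftFPD R := by
  apply le_antisymm
  · refine sSup_le ?_
    rintro _ ⟨M, rfl, hlt⟩
    obtain ⟨n, hn, ⟨c⟩, hmin⟩ := exists_of_resolutionDim_lt_top hlt
    rw [xGpd, hn]
    -- Length `0` is separate: `L` may then be zero, with `projectiveDimension` equal to `⊥`.
    obtain _ | n := n
    · exact zero_le
    obtain ⟨L, G, f, g, hs, hL, hG⟩ := exists_embedding_of_finiteResolution h𝔛 _ M c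
    refine le_sSup ⟨L, le_antisymm ?_ ?_, ENat.natCast_lt_top _⟩
    · exact (projectiveDimension_le_iff L (n + 1)).2 hL
    · refine (projectiveDimension_ge_iff L (n + 1)).2 fun hL' => ?_
      have := hmin n (nonempty_finiteResolution_of_embedding hs hG n hL')
      omega
  · refine sSup_le ?_
    rintro d ⟨M, hd, hlt⟩
    obtain ⟨n, rfl⟩ := ENat.ne_top_iff_exists.1 hlt.ne
    have hle : HasProjectiveDimensionLT M (n + 1) := (projectiveDimension_le_iff M n).1 hd.le
    have hge : ¬ HasProjectiveDimensionLT M n := (projectiveDimension_ge_iff M n).1 hd.ge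
    refine le_sSup ⟨M, resolutionDim_eq_coe ?_ ?_, hlt⟩
    · exact nonempty_finiteResolution_of_hasProjectiveDimensionLT
        (fun P hP => isXGorensteinProjective_iff.2 (maxCoresolving_of_projective hP)) n M hle
    · rintro m ⟨c⟩
      by_contra hmn
      have := hasProjectiveDimensionLT_of_finiteResolution h𝔛 hle c
      exact hge (hasProjectiveDimensionLT_of_ge M (m + 1) n (by omega))

end XGorenstein

theorem mainTheorem2 {R : Type u} [Ring R] (𝔛 : ObjectProperty (ModuleCat.{u} R))
    (h𝔛 : ∀ P : ModuleCat.{u} R, Module.Projective R P → 𝔛 P) :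
    XGorenstein.leftFGPD R = XGorenstein.leftXFGPD 𝔛 ∧
      XGorenstein.leftXFGPD 𝔛 = XGorenstein.leftFPD R := by
  exact ⟨XGorenstein.leftXFGPD_eq_leftFPD (fun _ hP => hP) |>.trans
    (XGorenstein.leftXFGPD_eq_leftFPD h𝔛).symm, XGorenstein.leftXFGPD_eq_leftFPD h𝔛⟩
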